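/- A faithful (unit) distance graph in $\mathbb{R}^d$ is a graph whose vertex set is a finite nonempty set $V\subset\mathbb{R}^d$ and in which two vertices $x,y\in V$ are adjacent if and only if their Euclidean distance $|x-y|$ is exactly $1$. The girth of a graph is the length of its shortest cycle ($+\infty$ if the graph has no cycle). For every $g\in\mathbb{N}$ there is a sequence $G_1,G_2,\ldots$, where $G_d$ is a faithful distance graph in $\mathbb{R}^d$ of girth greater than $g$, such that $\chi(G_d)=\Omega_g\!\left(\frac{d}{\log d}\right)$; that is, there is a constant $c=c(g)>0$ such that $\chi(G_d)\ge c\,\frac{d}{\log d}$ for all $d\ge 2$. -/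

import Mathlib

/-- The faithful (unit) distance graph in `ℝ^d` on the finite vertex set `V`:
two points of `V` are adjacent exactly when their Euclidean distance is `1`. -/
def faithfulDistanceGraph {d : ℕ} (V : Finset (EuclideanSpace ℝ (Fin d))) :
    SimpleGraph V where
  Adj x y := dist (x : EuclideanSpace ℝ (Fin d)) (y : EuclideanSpace ℝ (Fin d)) = 1
  symm := ⟨fun x y h => by rw [dist_comm]; exact h⟩
  loopless := ⟨fun x h => by simp at h⟩

/-!
The graph `G_d` is obtained in two independent steps: an abstract graph of bounded degree, large
girth and large chromatic number, and a faithful realization of bounded-degree graphs.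

*The abstract graph* (`SimpleGraph.exists_not_colorable`). Start from the empty graph on `n`
vertices, with `n` large, and add edges one at a time, joining only vertices of degree less than `D`
which are not connected by a walk of length at most `g`; this keeps all degrees at most `D` and the
girth above `g` (`SimpleGraph.lt_egirth_sup_edge`). As long as fewer than `D * n / 4` edges have
been added, at least half of the vertices are still available. By the Cauchy-Schwarz inequality
every colouring with `q` colours has at least `n ^ 2 / (4 * q)` monochromatic ordered pairs of
available vertices, of which only `O(n)` are too close to be joined. Averaging over pairs, some
admissible edge destroys a fraction at least `1 / (8 * q)` of the proper `q`-colourings that still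
exist (`SimpleGraph.exists_pair_monochromatic`). After about `8 * q * n * log q` steps none of
the initial `q ^ n` colourings is left, and `D` of order `q * log q` is enough to get that far.

*The realization* (`SimpleGraph.exists_orthogonal_representation`,
`exists_iso_faithfulDistanceGraph`). A graph of maximum degree at most `D` is a faithful distance
graph in dimension `2 * D + 1`. Place unit vectors one vertex at a time, each one generic in the
orthogonal complement of the vectors of its earlier neighbours, so that any `D + 1` of the vectors
are linearly independent. Independence guarantees that orthogonality to a non-neighbour is never
forced, and the dimension guarantees that independence survives. Two unit vectors scaled by
`1 / √2` are at distance `1` exactly when they are orthogonal.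

With `q` of order `d / log d` the degree bound satisfies `2 * D + 1 ≤ d`.
-/

open Finset

/-! ### Adding an edge between distant vertices -/

namespace SimpleGraph

/-- Joining two vertices that no walk of length at most `g` connects keeps the girth above `g`. -/
theorem lt_egirth_sup_edge {V : Type*} {G : SimpleGraph V} {g : ℕ} {u v : V}
    (hG : (g : ℕ∞) < G.egirth) (huv : ∀ w : G.Walk u v, g < w.length) :
    (g : ℕ∞) < (G ⊔ edge u v).egirth := by
  classical
  have key : ∀ {a b : V} (p : (G ⊔ edge u v).Walk a b), s(u, v) ∉ p.edges →
      ∀ e ∈ p.edges, e ∈ G.edgeSet := by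
    intro a b p hp e he
    have h := p.edges_subset_edgeSet he
    induction e with
    | _ x y =>
      rw [mem_edgeSet, sup_adj, edge_adj] at h
      rcases h with h | ⟨⟨rfl, rfl⟩ | ⟨rfl, rfl⟩, -⟩
      · exact h
      · exact absurd he hp
      · rw [Sym2.eq_swap] at he
        exact absurd he hp
  rw [← ENat.add_one_le_iff (ENat.natCast_ne_top g), le_egirth] at hG ⊢
  intro a c hc
  by_cases hmem : s(u, v) ∈ c.edges
  · have hu : u ∈ c.support := c.fst_mem_support_of_mem_edges hmem
    have hc' := hc.rotate hu
    have hv : v ∈ (c.rotate u hu).support := by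
      rw [Walk.mem_support_rotate_iff]
      exact c.snd_mem_support_of_mem_edges hmem
    have hlen : (c.rotate u hu).length = c.length := by simp
    generalize c.rotate u hu = c' at hc' hv hlen
    have hspec := c'.take_spec hv
    have hnd := hc'.isTrail.edges_nodup
    have hl : (c'.takeUntil v hv).length + (c'.dropUntil v hv).length = c.length := by
      rw [← Walk.length_append, hspec, hlen]
    rw [← hspec, Walk.edges_append] at hnd
    have hdisj := List.disjoint_of_nodup_append hnd
    -- The two arcs of the cycle between `u` and `v` share no edge, so one of them avoids `s(u, v)`.
    have : g + 1 ≤ c.length := by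
      by_cases h1 : s(u, v) ∈ (c'.takeUntil v hv).edges
      · have h2 : s(u, v) ∉ (c'.dropUntil v hv).edges := fun h => hdisj h1 h
        have := huv ((c'.dropUntil v hv).transfer G (key _ h2)).reverse
        rw [Walk.length_reverse, Walk.length_transfer] at this
        omega
      · have := huv ((c'.takeUntil v hv).transfer G (key _ h1))
        rw [Walk.length_transfer] at this
        omega
    exact_mod_cast this
  · have := hG _ _ (hc.transfer (key c hmem))
    rwa [Walk.length_transfer] at this

open Classical in
/-- A ball of radius `g` in a graph of maximum degree at most `D` has at most `(D + 1) ^ g`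
vertices. -/
theorem card_walk_length_le {V : Type*} [Fintype V] (G : SimpleGraph V) {D : ℕ}
    (hD : ∀ v, #{y | G.Adj v y} ≤ D) (u : V) (g : ℕ) :
    #{v | ∃ w : G.Walk u v, w.length ≤ g} ≤ (D + 1) ^ g := by
  induction g with
  | zero =>
    rw [pow_zero, card_le_one]
    intro a ha b hb
    simp only [mem_filter, mem_univ, true_and, nonpos_iff_eq_zero] at ha hb
    obtain ⟨w, hw⟩ := ha
    obtain ⟨w', hw'⟩ := hb
    rw [← Walk.eq_of_length_eq_zero hw, ← Walk.eq_of_length_eq_zero hw']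
  | succ g ih =>
    have hsub : ({v | ∃ w : G.Walk u v, w.length ≤ g + 1} : Finset V) ⊆
        ({v | ∃ w : G.Walk u v, w.length ≤ g} : Finset V).biUnion
          fun x => insert x ({y | G.Adj x y} : Finset V) := by
      intro v hv
      simp only [mem_filter, mem_univ, true_and, mem_biUnion, mem_insert] at hv ⊢
      obtain ⟨w, hw⟩ := hv
      induction w using Walk.concatRec with
      | Hnil => exact ⟨_, ⟨Walk.nil, by simp⟩, Or.inl rfl⟩
      | Hconcat p h _ =>
        rw [Walk.length_concat] at hw
        exact ⟨_, ⟨p, by omega⟩, Or.inr h⟩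
    calc _ ≤ _ := card_le_card hsub
      _ ≤ #{v | ∃ w : G.Walk u v, w.length ≤ g} * (D + 1) :=
        card_biUnion_le_card_mul _ _ _ fun x _ => (card_insert_le _ _).trans (Nat.succ_le_succ (hD x))
      _ ≤ (D + 1) ^ g * (D + 1) := Nat.mul_le_mul_right _ ih
      _ = _ := (pow_succ _ _).symm

/-! ### Counting proper colourings -/

open Classical in
/-- The proper colourings of `G` with colours in `Fin q`, as a finite set of functions. -/
noncomputable def properColorings {V : Type*} [Fintype V] (G : SimpleGraph V) (q : ℕ) :
    Finset (V → Fin q) :=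
  {c | ∀ x y, G.Adj x y → c x ≠ c y}

theorem mem_properColorings {V : Type*} [Fintype V] {G : SimpleGraph V} {q : ℕ}
    {c : V → Fin q} : c ∈ G.properColorings q ↔ ∀ x y, G.Adj x y → c x ≠ c y := by
  simp [properColorings]

open Classical in
theorem properColorings_sup_edge {V : Type*} [Fintype V] {G : SimpleGraph V} {q : ℕ}
    {u v : V} (huv : u ≠ v) :
    (G ⊔ edge u v).properColorings q = {c ∈ G.properColorings q | ¬ c u = c v} := by
  ext c
  simp only [mem_properColorings, mem_filter, sup_adj, edge_adj]
  constructor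
  · exact fun h => ⟨fun x y hxy => h x y (Or.inl hxy), h u v (Or.inr ⟨Or.inl ⟨rfl, rfl⟩, huv⟩)⟩
  · rintro ⟨h, h'⟩ x y (hxy | ⟨⟨rfl, rfl⟩ | ⟨rfl, rfl⟩, -⟩)
    · exact h x y hxy
    · exact h'
    · exact fun e => h' e.symm

open Classical in
/-- A colouring of `U` with `q` colours has at least `#U ^ 2 / q` monochromatic ordered pairs,
diagonal pairs included. -/
theorem sq_card_le_mul_card_monochromatic {V : Type*} {q : ℕ} (U : Finset V)
    (c : V → Fin q) : #U ^ 2 ≤ q * #{p ∈ U ×ˢ U | c p.1 = c p.2} := by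
  have h1 : #U = ∑ i : Fin q, #{x ∈ U | c x = i} :=
    card_eq_sum_card_fiberwise fun _ _ => mem_univ _
  have h2 : #{p ∈ U ×ˢ U | c p.1 = c p.2} = ∑ i : Fin q, #{x ∈ U | c x = i} ^ 2 := by
    rw [card_eq_sum_card_fiberwise (f := fun p => c p.1) (t := univ) fun _ _ => mem_univ _]
    refine sum_congr rfl fun i _ => ?_
    rw [sq, ← card_product]
    congr 1
    ext p
    simp only [mem_filter, mem_product]
    grind
  rw [h2]
  conv_lhs => rw [h1]
  simpa using sq_sum_le_card_mul_sum_sq (s := (univ : Finset (Fin q)))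
    (f := fun i => #{x ∈ U | c x = i})

open Classical in
/-- Given a set `S` of colourings with `q` colours and a set `U` containing at least half of the
vertices, some pair of vertices of `U` that are not near each other is monochromatic for a fraction
at least `1 / (8 * q)` of the colourings in `S`. -/
theorem exists_pair_monochromatic {n q B : ℕ} (near : Fin n → Fin n → Prop)
    (hnear : ∀ u, #{v | near u v} ≤ B) (U : Finset (Fin n)) (hU : n ≤ 2 * #U)
    (hn : 8 * q * B ≤ n) (S : Finset (Fin n → Fin q)) (hn0 : 0 < n) (hS : S.Nonempty) :
    ∃ u ∈ U, ∃ v ∈ U, ¬ near u v ∧ #S ≤ 8 * q * #{c ∈ S | c u = c v} := by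
  set P : Finset (Fin n × Fin n) := {p ∈ U ×ˢ U | ¬ near p.1 p.2} with hP
  have hUn : #U ≤ n := by simpa using card_le_univ U
  have hcol : ∀ c ∈ S, n ^ 2 ≤ 8 * q * #{p ∈ P | c p.1 = c p.2} := by
    intro c _
    have h1 := sq_card_le_mul_card_monochromatic U c
    have h2 : #{p ∈ U ×ˢ U | c p.1 = c p.2} ≤
        #{p ∈ P | c p.1 = c p.2} + #{p ∈ U ×ˢ U | near p.1 p.2} := by
      refine (card_le_card ?_).trans (card_union_le _ _)
      intro p
      simp only [hP, mem_filter, mem_product, mem_union]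
      tauto
    have h3 : #{p ∈ U ×ˢ U | near p.1 p.2} ≤ #U * B := by
      rw [card_filter, sum_product]
      refine (sum_le_card_nsmul U _ B fun u _ => ?_).trans (by simp)
      rw [← card_filter]
      exact (card_le_card (filter_subset_filter _ (subset_univ _))).trans (hnear u)
    have h4 : #U ^ 2 ≤ q * #{p ∈ P | c p.1 = c p.2} + #U * (q * B) := by
      calc _ ≤ _ := h1
        _ ≤ q * (#{p ∈ P | c p.1 = c p.2} + #U * B) := Nat.mul_le_mul_left _ (by omega)
        _ = _ := by ring
    have h5 : #U * (8 * (q * B)) ≤ #U * n := Nat.mul_le_mul_left _ (by linarith)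
    nlinarith
  -- Count the triples of a colouring in `S` and a pair in `P` monochromatic for it in two ways.
  by_contra! hcon
  have hpair : ∀ p ∈ P, 8 * q * #{c ∈ S | c p.1 = c p.2} < #S := by
    intro p hp
    simp only [hP, mem_filter, mem_product] at hp
    exact hcon _ hp.1.1 _ hp.1.2 hp.2
  have hdc : ∑ c ∈ S, #{p ∈ P | c p.1 = c p.2} = ∑ p ∈ P, #{c ∈ S | c p.1 = c p.2} := by
    simp only [card_filter]
    exact sum_comm
  have hPc : #P ≤ n ^ 2 := by
    calc #P ≤ #(U ×ˢ U) := card_filter_le _ _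
      _ = #U ^ 2 := by rw [card_product, sq]
      _ ≤ n ^ 2 := Nat.pow_le_pow_left hUn 2
  have hlow : #S * n ^ 2 ≤ ∑ p ∈ P, 8 * q * #{c ∈ S | c p.1 = c p.2} := by
    rw [← mul_sum, ← hdc, mul_sum, ← smul_eq_mul]
    exact card_nsmul_le_sum _ _ _ hcol
  have hpos : 0 < #S * n ^ 2 := by have := hS.card_pos; positivity
  rcases P.eq_empty_or_nonempty with hPe | hPe
  · rw [hPe, sum_empty] at hlow
    omega
  · have : ∑ p ∈ P, 8 * q * #{c ∈ S | c p.1 = c p.2} < #P * #S := by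
      simpa using sum_lt_sum_of_nonempty hPe hpair
    have := Nat.mul_le_mul_right #S hPc
    nlinarith

open Classical in
theorem card_adj_le_of_le_sup_edge {V : Type*} [Fintype V] {G H : SimpleGraph V} {u v : V}
    (hH : H ≤ G ⊔ edge u v) (x : V) :
    #{y | H.Adj x y} ≤
      #{y | G.Adj x y} + ((if x = u then 1 else 0) + (if x = v then 1 else 0)) := by
  have hsub : ({y | H.Adj x y} : Finset V) ⊆
      ({y | G.Adj x y} : Finset V) ∪ ((if x = u then {v} else ∅) ∪ (if x = v then {u} else ∅)) := by
    intro y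
    simp only [mem_filter, mem_univ, true_and, mem_union]
    intro hxy
    have h := hH hxy
    rw [sup_adj, edge_adj] at h
    rcases h with h | ⟨⟨rfl, rfl⟩ | ⟨rfl, rfl⟩, -⟩
    · exact Or.inl h
    · simp
    · simp
  refine (card_le_card hsub).trans ((card_union_le _ _).trans ?_)
  gcongr
  refine (card_union_le _ _).trans ?_
  split_ifs <;> simp

/-! ### The greedy construction -/

open Classical in
/-- The state of the greedy construction after `t` steps: degrees at most `D`, at most `t` edges,
girth above `g`, and the number of proper `q`-colourings reduced by the factor `1 - 1 / (8 * q)`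
in each step. -/
theorem exists_card_properColorings_le {n q g D : ℕ} (hq : 0 < q) (hn0 : 0 < n)
    (hn : 8 * q * (D + 1) ^ g ≤ n) (t : ℕ) (ht : 4 * t ≤ D * n) :
    ∃ G : SimpleGraph (Fin n), (∀ v, #{y | G.Adj v y} ≤ D) ∧
      ∑ v, #{y | G.Adj v y} ≤ 2 * t ∧ (g : ℕ∞) < G.egirth ∧
      (8 * q) ^ t * #(G.properColorings q) ≤ (8 * q - 1) ^ t * q ^ n := by
  induction t with
  | zero =>
    refine ⟨⊥, by simp, by simp, by rw [egirth_bot]; exact ENat.natCast_lt_top g, ?_⟩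
    simpa using card_le_univ ((⊥ : SimpleGraph (Fin n)).properColorings q)
  | succ t ih =>
    obtain ⟨G, hdeg, hsum, hgirth, hcard⟩ := ih (by omega)
    rcases (G.properColorings q).eq_empty_or_nonempty with hS | hS
    · exact ⟨G, hdeg, by omega, hgirth, by simp [hS]⟩
    -- The vertices that can still receive an edge; the degree sum shows that they are at least half.
    set U : Finset (Fin n) := {v | #{y | G.Adj v y} < D} with hUdef
    have hD : 0 < D := by
      rcases Nat.eq_zero_or_pos D with rfl | h
      · omega
      · exact h
    have hU : n ≤ 2 * #U := by
      have h1 : #(univ \ U) * D ≤ ∑ v, #{y | G.Adj v y} := by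
        calc #(univ \ U) * D ≤ ∑ v ∈ univ \ U, #{y | G.Adj v y} := by
              rw [← smul_eq_mul]
              refine card_nsmul_le_sum _ _ _ fun x hx => ?_
              simpa [hUdef] using hx
          _ ≤ _ := sum_le_sum_of_subset (subset_univ _)
      have h2 : #(univ \ U) + #U = n := by
        rw [card_sdiff_add_card_eq_card (subset_univ _)]; simp
      have h3 : D * (2 * #(univ \ U)) ≤ D * n := by nlinarith
      have := Nat.le_of_mul_le_mul_left h3 hD
      omega
    obtain ⟨u, hu, v, hv, hnear, hkill⟩ := exists_pair_monochromatic
      (fun u v => ∃ w : G.Walk u v, w.length ≤ g) (fun u => G.card_walk_length_le hdeg u g)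
      U hU hn (G.properColorings q) hn0 hS
    push Not at hnear
    have huv : u ≠ v := by
      rintro rfl
      exact absurd (hnear Walk.nil) (by simp)
    simp only [hUdef, mem_filter, mem_univ, true_and] at hu hv
    obtain ⟨H, hH⟩ : ∃ H, H = G ⊔ edge u v := ⟨_, rfl⟩
    have hadd : ∀ x, #{y | H.Adj x y} ≤
        #{y | G.Adj x y} + ((if x = u then 1 else 0) + (if x = v then 1 else 0)) := fun x => by
      convert card_adj_le_of_le_sup_edge hH.le x
    refine ⟨H, fun x => ?_, ?_, hH ▸ lt_egirth_sup_edge hgirth hnear, ?_⟩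
    · refine (hadd x).trans ?_
      by_cases hxu : x = u
      · subst hxu
        simpa [huv] using hu
      · by_cases hxv : x = v
        · subst hxv
          simpa [hxu] using hv
        · simpa [hxu, hxv] using hdeg x
    · refine (sum_le_sum fun x _ => hadd x).trans ?_
      rw [sum_add_distrib, sum_add_distrib]
      simp only [sum_ite_eq', mem_univ, if_true]
      omega
    · rw [hH, properColorings_sup_edge huv]
      have hsplit := card_filter_add_card_filter_not (s := G.properColorings q)
        (fun c => c u = c v)
      set a := #{c ∈ G.properColorings q | c u = c v}
      set b := #{c ∈ G.properColorings q | ¬ c u = c v}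
      have hstep : 8 * q * b ≤ (8 * q - 1) * #(G.properColorings q) := by
        obtain ⟨k, hk⟩ : ∃ k, 8 * q = k + 1 := ⟨8 * q - 1, by omega⟩
        rw [hk] at hkill ⊢
        rw [← hsplit] at hkill ⊢
        simp only [Nat.add_sub_cancel]
        nlinarith
      calc (8 * q) ^ (t + 1) * b = (8 * q) ^ t * (8 * q * b) := by ring
        _ ≤ (8 * q) ^ t * ((8 * q - 1) * #(G.properColorings q)) := Nat.mul_le_mul_left _ hstep
        _ = (8 * q - 1) * ((8 * q) ^ t * #(G.properColorings q)) := by ring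
        _ ≤ (8 * q - 1) * ((8 * q - 1) ^ t * q ^ n) := Nat.mul_le_mul_left _ hcard
        _ = _ := by ring

/-- The estimate `(1 - 1 / m) ^ m ≤ 1 / 2`, cleared of denominators. -/
theorem two_mul_pred_pow_le {m : ℕ} (hm : 0 < m) : 2 * (m - 1) ^ m ≤ m ^ m := by
  obtain ⟨k, rfl⟩ : ∃ k, m = k + 1 := ⟨m - 1, by omega⟩
  rw [Nat.add_sub_cancel]
  have h := pow_add_mul_le_add_pow (a := k) (b := 1) (n := k + 1)
  have : k ^ (k + 1) + (k + 1) * k ^ k ≤ (k + 1) ^ (k + 1) := by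
    simpa using h
  calc 2 * k ^ (k + 1) ≤ k ^ (k + 1) + (k + 1) * k ^ k := by ring_nf; nlinarith [Nat.zero_le (k ^ k)]
    _ ≤ _ := this

open Classical in
/-- There are graphs of girth above `g` and maximum degree `O(q * log q)` that are not
`q`-colourable; `L` stands for an upper bound on the binary logarithm of `q`. -/
theorem exists_not_colorable (g : ℕ) {q L : ℕ} (hq : 0 < q) (hL : q ≤ 2 ^ L) :
    ∃ n : ℕ, 0 < n ∧ ∃ G : SimpleGraph (Fin n), (∀ v, #{y | G.Adj v y} ≤ 32 * q * (L + 1)) ∧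
      (g : ℕ∞) < G.egirth ∧ ¬ G.Colorable q := by
  set D := 32 * q * (L + 1) with hD
  set n := 8 * q * (D + 1) ^ g with hn
  have hn0 : 0 < n := by positivity
  obtain ⟨G, hdeg, -, hgirth, hcard⟩ := exists_card_properColorings_le (g := g) hq hn0 hn.ge
    (8 * q * (n * (L + 1))) (by rw [hD]; apply le_of_eq; ring)
  refine ⟨n, hn0, G, hdeg, hgirth, ?_⟩
  rintro ⟨C⟩
  have hmem : (C : Fin n → Fin q) ∈ G.properColorings q :=
    mem_properColorings.2 fun x y h => C.valid h
  have h1 : 1 ≤ #(G.properColorings q) := card_pos.2 ⟨_, hmem⟩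
  have h2 : 2 ^ (n * (L + 1)) * (8 * q - 1) ^ (8 * q * (n * (L + 1))) ≤
      (8 * q) ^ (8 * q * (n * (L + 1))) := by
    rw [pow_mul (8 * q - 1), pow_mul (8 * q) (8 * q), ← mul_pow]
    exact Nat.pow_le_pow_left (two_mul_pred_pow_le (by omega)) _
  have h3 : q ^ n < 2 ^ (n * (L + 1)) := by
    calc q ^ n ≤ (2 ^ L) ^ n := Nat.pow_le_pow_left hL n
      _ = 2 ^ (n * L) := by rw [← pow_mul, mul_comm]
      _ < _ := Nat.pow_lt_pow_right (by norm_num) (by nlinarith)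
  have h4 : 0 < (8 * q - 1) ^ (8 * q * (n * (L + 1))) := Nat.pow_pos (by omega)
  have h5 := Nat.mul_lt_mul_of_pos_left h3 h4
  have h6 := Nat.le_mul_of_pos_right ((8 * q) ^ (8 * q * (n * (L + 1)))) h1
  rw [mul_comm] at h2
  exact absurd (h2.trans (h6.trans hcard)) (not_le.2 h5)

end SimpleGraph

/-! ### Realizing graphs of bounded degree -/

/-- A subspace over an infinite field is not covered by finitely many subspaces unless one of them
contains it. -/
theorem Submodule.exists_mem_forall_notMem {K E : Type*} [DivisionRing K] [Infinite K]
    [AddCommGroup E] [Module K E] (U : Submodule K E) {ι : Type*} (s : Finset ι)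
    (W : ι → Submodule K E) (hW : ∀ i ∈ s, ¬ U ≤ W i) : ∃ z ∈ U, ∀ i ∈ s, z ∉ W i := by
  classical
  have h := Subspace.biUnion_ne_univ_of_top_notMem
    (s := s.image fun i => (W i).comap U.subtype) (by
      simp only [mem_image, not_exists, not_and]
      intro i hi htop
      refine hW i hi fun x hx => ?_
      have : (⟨x, hx⟩ : U) ∈ (W i).comap U.subtype := htop ▸ Submodule.mem_top
      exact this)
  obtain ⟨z, hz⟩ := (Set.ne_univ_iff_exists_notMem _).1 h
  simp only [mem_image, Set.iUnion_exists, Set.biUnion_and', Set.iUnion_iUnion_eq_right,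
    Set.mem_iUnion, not_exists] at hz
  exact ⟨z, z.2, fun i hi => hz i hi⟩

open Classical in
/-- A graph of maximum degree at most `D` has an orthogonal representation by unit vectors in
dimension `2 * D + 1` that is faithful (non-adjacent vertices get non-orthogonal vectors) and in
which any `D + 1` vectors are linearly independent. The representation is built on `s` one vertex
at a time, so it is stated for the subgraph induced on `s`. -/
theorem SimpleGraph.exists_orthogonal_representation {V E : Type*} [Fintype V]
    [NormedAddCommGroup E] [InnerProductSpace ℝ E] [FiniteDimensional ℝ E]
    (G : SimpleGraph V) {D : ℕ} (hdeg : ∀ v, #{y | G.Adj v y} ≤ D)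
    (hE : 2 * D + 1 ≤ Module.finrank ℝ E) (s : Finset V) :
    ∃ f : V → E, (∀ x ∈ s, ‖f x‖ = 1) ∧
      (∀ x ∈ s, ∀ y ∈ s, x ≠ y → (inner ℝ (f x) (f y) = 0 ↔ G.Adj x y)) ∧
      ∀ T ⊆ s, #T ≤ D + 1 → LinearIndepOn ℝ f (T : Set V) := by
  induction s using Finset.induction_on with
  | empty =>
    refine ⟨fun _ => 0, by simp, by simp, fun T hT _ => ?_⟩
    rw [subset_empty.1 hT, coe_empty]
    exact linearIndepOn_empty ℝ _
  | insert a s ha ih =>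
    obtain ⟨f, hnorm, horth, hind⟩ := ih
    set N : Finset V := {y ∈ s | G.Adj a y} with hN
    have hNs : N ⊆ s := filter_subset _ _
    have hNc : #N ≤ D := (card_le_card (filter_subset_filter _ (subset_univ s))).trans (hdeg a)
    have hrank : ∀ T : Finset V, Module.finrank ℝ (Submodule.span ℝ (f '' T)) ≤ #T := by
      intro T
      rw [← coe_image]
      exact (finrank_span_finset_le_card (R := ℝ) (T.image f)).trans card_image_le
    set U : Submodule ℝ E := (Submodule.span ℝ (f '' N))ᗮ with hUdef
    have hUr : D + 1 ≤ Module.finrank ℝ U := by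
      have := (Submodule.span ℝ (f '' N)).finrank_add_finrank_orthogonal
      have := hrank N
      rw [← hUdef] at *
      omega
    -- The new vector has to avoid the spans of at most `D` old vectors, which are too small to
    -- contain `U`, and the orthogonal complements of old non-neighbours `y`: if one of these
    -- contained `U`, then `f y` would lie in the span of the at most `D` old neighbours.
    obtain ⟨z, hzU, hz⟩ := U.exists_mem_forall_notMem
      ((s.powerset.filter fun T => #T ≤ D).disjSum (s \ N))
      (Sum.elim (fun T => Submodule.span ℝ (f '' T)) fun y => (ℝ ∙ f y)ᗮ) (by
        rintro (T | y) hmem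
        · simp only [inl_mem_disjSum, mem_filter, mem_powerset] at hmem
          intro hle
          have h1 : Module.finrank ℝ U ≤ Module.finrank ℝ (Submodule.span ℝ (f '' T)) :=
            Submodule.finrank_mono hle
          have h2 := hrank T
          omega
        · simp only [inr_mem_disjSum, mem_sdiff] at hmem
          intro hle
          have h1 := Submodule.orthogonal_le hle
          simp only [Sum.elim_inr, hUdef, Submodule.orthogonal_orthogonal] at h1
          have h2 : f y ∈ Submodule.span ℝ (f '' N) := h1 (Submodule.mem_span_singleton_self _)
          have h3 := hind (insert y N) (insert_subset hmem.1 hNs)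
            ((card_insert_le _ _).trans (by omega))
          rw [coe_insert] at h3
          exact h3.notMem_span_of_insert (by simpa using hmem.2) h2)
    have hz1 : ∀ T ⊆ s, #T ≤ D → z ∉ Submodule.span ℝ (f '' T) := fun T hT hTc =>
      hz (Sum.inl T) (by simp [hT, hTc])
    have hz2 : ∀ y ∈ s, ¬ G.Adj a y → inner ℝ (f y) z ≠ 0 := fun y hy hay h =>
      hz (Sum.inr y) (by simp [hN, hy, hay]) (Submodule.mem_orthogonal_singleton_iff_inner_right.2 h)
    have hz3 : ∀ y ∈ s, G.Adj a y → inner ℝ (f y) z = 0 := fun y hy hay =>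
      (Submodule.mem_orthogonal _ _).1 hzU _
        (Submodule.subset_span ⟨y, by simp [hN, hy, hay], rfl⟩)
    have hz0 : z ≠ 0 := fun h => hz1 ∅ (empty_subset _) (by simp) (h ▸ Submodule.zero_mem _)
    have hzn : ‖z‖⁻¹ ≠ 0 := inv_ne_zero (norm_ne_zero_iff.2 hz0)
    have hne : ∀ x ∈ s, x ≠ a := fun x hx h => ha (h ▸ hx)
    have hinner : ∀ y ∈ s, (inner ℝ (f y) (‖z‖⁻¹ • z) = 0 ↔ G.Adj a y) := by
      intro y hy
      rw [inner_smul_right, mul_eq_zero, or_iff_right hzn]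
      exact ⟨fun h => by_contra fun hay => hz2 y hy hay h, hz3 y hy⟩
    refine ⟨Function.update f a (‖z‖⁻¹ • z), ?_, ?_, ?_⟩
    · intro x hx
      rcases mem_insert.1 hx with rfl | hx
      · rw [Function.update_self]
        exact norm_smul_inv_norm (𝕜 := ℝ) hz0
      · rw [Function.update_of_ne (hne x hx)]
        exact hnorm x hx
    · intro x hx y hy hxy
      rcases mem_insert.1 hx with rfl | hxs <;> rcases mem_insert.1 hy with rfl | hys
      · exact absurd rfl hxy
      · rw [Function.update_self, Function.update_of_ne (hne y hys), real_inner_comm]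
        exact hinner y hys
      · rw [Function.update_self, Function.update_of_ne (hne x hxs), G.adj_comm]
        exact hinner x hxs
      · rw [Function.update_of_ne (hne x hxs), Function.update_of_ne (hne y hys)]
        exact horth x hxs y hys hxy
    · have hcongr : ∀ T ⊆ s, Set.EqOn (Function.update f a (‖z‖⁻¹ • z)) f (T : Set V) :=
        fun T hT x hx => Function.update_of_ne (hne x (hT hx)) _ _
      intro T hT hTc
      by_cases haT : a ∈ T
      · have hT' : T.erase a ⊆ s := fun x hx => by
          have := hT (mem_of_mem_erase hx)
          exact (mem_insert.1 this).resolve_left (ne_of_mem_erase hx)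
        have hcard := card_erase_add_one haT
        rw [← insert_erase haT, coe_insert, linearIndepOn_insert (by simp)]
        refine ⟨(linearIndepOn_congr (hcongr _ hT')).2 (hind _ hT' (by omega)), ?_⟩
        rw [(hcongr _ hT').image_eq, Function.update_self, Submodule.smul_mem_iff _ hzn]
        exact hz1 _ hT' (by omega)
      · have hT' : T ⊆ s := fun x hx =>
          (mem_insert.1 (hT hx)).resolve_left fun h => haT (h ▸ hx)
        exact (linearIndepOn_congr (hcongr T hT')).2 (hind T hT' hTc)

open Classical in
/-- A graph of maximum degree at most `D` is isomorphic to a faithful distance graph in every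
dimension at least `2 * D + 1`. Positivity of `D` makes any two of the chosen vectors independent,
hence distinct. -/
theorem exists_iso_faithfulDistanceGraph {V : Type*} [Fintype V]
    (G : SimpleGraph V) {D d : ℕ} (hD : 0 < D) (hdeg : ∀ v, #{y | G.Adj v y} ≤ D)
    (hd : 2 * D + 1 ≤ d) :
    ∃ P : Finset (EuclideanSpace ℝ (Fin d)), Nonempty (G ≃g faithfulDistanceGraph P) := by
  obtain ⟨f, hnorm, horth, hind⟩ := G.exists_orthogonal_representation
    (E := EuclideanSpace ℝ (Fin d)) hdeg (by simpa using hd) univ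
  have hinj : Function.Injective f := by
    intro x y hxy
    by_contra hne
    have h := hind {x, y} (subset_univ _) (card_le_two.trans (by omega))
    exact hne (h.injOn (by simp) (by simp) hxy)
  have hs : (√2 : ℝ)⁻¹ ≠ 0 := by positivity
  set e : V → EuclideanSpace ℝ (Fin d) := fun x => (√2 : ℝ)⁻¹ • f x with he
  have heinj : Function.Injective e := (smul_right_injective _ hs).comp hinj
  have hdist : ∀ x y, dist (e x) (e y) = 1 ↔ G.Adj x y := by
    intro x y
    rcases eq_or_ne x y with rfl | hne
    · simp
    rw [← horth x (mem_univ _) y (mem_univ _) hne, dist_eq_norm, ← smul_sub, norm_smul,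
      Real.norm_of_nonneg (by positivity), inv_mul_eq_one₀ (by positivity)]
    have h := norm_sub_sq_real (f x) (f y)
    rw [hnorm x (mem_univ _), hnorm y (mem_univ _)] at h
    rw [eq_comm, ← sq_eq_sq₀ (norm_nonneg _) (by positivity), Real.sq_sqrt (by norm_num), h]
    constructor <;> intro h' <;> linarith
  refine ⟨univ.image e, ⟨⟨Equiv.ofBijective (fun x => ⟨e x, mem_image_of_mem _ (mem_univ _)⟩)
    ⟨fun x y h => heinj (congrArg Subtype.val h), ?_⟩, ?_⟩⟩⟩
  · rintro ⟨y, hy⟩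
    obtain ⟨x, -, rfl⟩ := mem_image.1 hy
    exact ⟨x, rfl⟩
  · intro x y
    exact hdist x y

/-! ### Choice of the parameters -/

theorem lt_egirth_faithfulDistanceGraph_singleton (g : ℕ) {d : ℕ}
    (x : EuclideanSpace ℝ (Fin d)) :
    (g : ℕ∞) < (faithfulDistanceGraph {x}).egirth := by
  rw [SimpleGraph.IsAcyclic.egirth_eq_top]
  · exact ENat.natCast_lt_top g
  · intro v w hw
    exact (w.adj_snd hw.not_nil).ne (Subtype.ext (by
      rw [mem_singleton.1 v.2, mem_singleton.1 w.snd.2]))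

theorem exists_faithfulDistanceGraph_chromaticNumber (g : ℕ) {d : ℕ} (hd : 2 ≤ d) :
    ∃ P : Finset (EuclideanSpace ℝ (Fin d)), P.Nonempty ∧
      (g : ℕ∞) < (faithfulDistanceGraph P).egirth ∧
      1 / 640 * ((d : ℝ) / Real.log d) ≤ ((faithfulDistanceGraph P).chromaticNumber.toNat : ℝ) := by
  have hd2 : (2 : ℝ) ≤ d := by exact_mod_cast hd
  have hlog2 : Real.log 2 ≤ Real.log d := Real.log_le_log (by norm_num) hd2
  have hl2 := Real.log_two_gt_d9
  have hlog : 0 < Real.log d := by linarith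
  set q := ⌊1 / 640 * ((d : ℝ) / Real.log d)⌋₊ with hq
  have hqlt : 1 / 640 * ((d : ℝ) / Real.log d) < q + 1 := Nat.lt_floor_add_one _
  -- It suffices to have a graph that is not `q`-colourable.
  suffices h : ∃ P : Finset (EuclideanSpace ℝ (Fin d)), P.Nonempty ∧
      (g : ℕ∞) < (faithfulDistanceGraph P).egirth ∧ ¬ (faithfulDistanceGraph P).Colorable q by
    obtain ⟨P, h1, h2, h3⟩ := h
    refine ⟨P, h1, h2, hqlt.le.trans ?_⟩
    have hfin : (faithfulDistanceGraph P).chromaticNumber ≠ ⊤ :=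
      SimpleGraph.chromaticNumber_ne_top_iff_exists.2
        ⟨_, (faithfulDistanceGraph P).colorable_of_fintype⟩
    have : q + 1 ≤ (faithfulDistanceGraph P).chromaticNumber.toNat := by
      by_contra! hlt
      apply h3
      rw [← SimpleGraph.chromaticNumber_le_iff_colorable, ← ENat.natCast_toNat hfin]
      exact_mod_cast Nat.lt_succ_iff.1 hlt
    exact_mod_cast this
  -- For small `d` the floor vanishes and a single point is enough.
  rcases Nat.eq_zero_or_pos q with hq0 | hq0
  · refine ⟨{0}, singleton_nonempty _, ?_, ?_⟩
    · exact lt_egirth_faithfulDistanceGraph_singleton g 0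
    · rw [hq0]
      rintro ⟨C⟩
      exact (C ⟨0, by simp⟩).elim0
  set L := Nat.log 2 d + 1 with hL
  have hqle : (q : ℝ) ≤ 1 / 640 * ((d : ℝ) / Real.log d) := Nat.floor_le (by positivity)
  have hqlog : 640 * (q * Real.log d) ≤ d := by
    have := mul_le_mul_of_nonneg_right hqle hlog.le
    have h' : 1 / 640 * ((d : ℝ) / Real.log d) * Real.log d = d / 640 := by field_simp
    linarith
  have hqd : q ≤ d := by
    have : (q : ℝ) ≤ d := by nlinarith [(Nat.cast_nonneg q : (0 : ℝ) ≤ q)]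
    exact_mod_cast this
  have hqL : q ≤ 2 ^ L := hqd.trans (Nat.lt_pow_succ_log_self (by norm_num) d).le
  have hLlog : ((L : ℝ) + 1) ≤ 5 * Real.log d := by
    have h1 : (2 : ℝ) ^ Nat.log 2 d ≤ d := by exact_mod_cast Nat.pow_log_le_self 2 (by omega)
    have h2 := Real.log_le_log (by positivity) h1
    rw [Real.log_pow] at h2
    have h3 : (L : ℝ) = Nat.log 2 d + 1 := by rw [hL]; push_cast; ring
    rw [h3]
    nlinarith [(Nat.cast_nonneg (Nat.log 2 d) : (0 : ℝ) ≤ _)]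
  have hdim : 2 * (32 * q * (L + 1)) + 1 ≤ d := by
    have : (2 * (32 * q * (L + 1)) + 1 : ℝ) ≤ d := by
      have := mul_le_mul_of_nonneg_left hLlog (Nat.cast_nonneg q : (0 : ℝ) ≤ q)
      linarith
    exact_mod_cast this
  obtain ⟨n, hn, G, hdeg, hgirth, hcol⟩ := SimpleGraph.exists_not_colorable g hq0 hqL
  obtain ⟨P, ⟨φ⟩⟩ := exists_iso_faithfulDistanceGraph G (by positivity) hdeg hdim
  refine ⟨P, ⟨_, (φ ⟨0, hn⟩).2⟩, φ.egirth_eq ▸ hgirth, fun h => hcol ?_⟩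
  exact h.of_hom φ.toHom

theorem proposition2 (g : ℕ) :
    ∃ V : (d : ℕ) → Finset (EuclideanSpace ℝ (Fin d)),
      (∀ d : ℕ, 1 ≤ d →
        (V d).Nonempty ∧ (g : ℕ∞) < (faithfulDistanceGraph (V d)).egirth) ∧
      ∃ c : ℝ, 0 < c ∧ ∀ d : ℕ, 2 ≤ d →
        c * ((d : ℝ) / Real.log (d : ℝ)) ≤
          ((faithfulDistanceGraph (V d)).chromaticNumber.toNat : ℝ) := by
  have h : ∀ d : ℕ, ∃ P : Finset (EuclideanSpace ℝ (Fin d)), P.Nonempty ∧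
      (g : ℕ∞) < (faithfulDistanceGraph P).egirth ∧ (2 ≤ d →
      1 / 640 * ((d : ℝ) / Real.log d) ≤
        ((faithfulDistanceGraph P).chromaticNumber.toNat : ℝ)) := by
    intro d
    rcases Nat.lt_or_ge d 2 with hd | hd
    · exact ⟨{0}, singleton_nonempty _, lt_egirth_faithfulDistanceGraph_singleton g 0,
        fun h => absurd h (by omega)⟩
    · obtain ⟨P, h1, h2, h3⟩ := exists_faithfulDistanceGraph_chromaticNumber g hd
      exact ⟨P, h1, h2, fun _ => h3⟩
  choose V h1 h2 h3 using h
  exact ⟨V, fun d _ => ⟨h1 d, h2 d⟩, 1 / 640, by norm_num, h3⟩
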